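/- Let $\mathcal P$ be the infinite graph with vertices $v_{i,j}$ ($i,j\in\mathbb N$) and edges $v_{i,j}v_{i,j+1}$ ($i,j\in\mathbb N$), and let $V_j=\{v_{i,j}: i\in\mathbb N\}$ be its $j$-th column. For an infinite word $\alpha=(\alpha_j)_{j\in\mathbb N}$ over the alphabet $\{0,1,2\}$, let $\mathcal P^{\alpha}$ be the graph obtained from $\mathcal P$ by the following changes, for every $j$: if $\alpha_j=1$, the adjacency of $v_{i,j}$ and $v_{k,j+1}$ is complemented for all $i,k$; if $\alpha_j=2$, the adjacency of $v_{i,j}$ and $v_{k,j+1}$ is complemented for all $i<k$; if $\alpha_j=0$, nothing is changed between $V_j$ and $V_{j+1}$. Let $\mathcal G_\alpha$ be the class of all finite induced subgraphs of $\mathcal P^{\alpha}$. The clique-width of a finite graph is the least number of labels needed to construct it by creation of labelled vertices, disjoint union, adding all edges between the vertices labelled $i$ and the vertices labelled $j$ (for labels $i\neq j$), and renaming a label. If $\alpha$ contains the letter $2$ infinitely many times, then the class $\mathcal G_\alpha$ has unbounded clique-width; that is, for every $c\in\mathbb N$ there is a graph in $\mathcal G_\alpha$ whose clique-width is greater than $c$.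 -/

import Mathlib

/-- Expressions over the label set `Fin k` built from the four operations of clique-width: creation
of a vertex with label `i`, disjoint union, joining all vertices labelled `i` to all vertices
labelled `j` (for distinct `i`, `j`), and renaming label `i` to label `j`. -/
inductive CliqueExpr (k : ℕ) : Type
  | vertex (i : Fin k) : CliqueExpr k
  | union (a b : CliqueExpr k) : CliqueExpr k
  | join (i j : Fin k) (hij : i ≠ j) (a : CliqueExpr k) : CliqueExpr k
  | rename (i j : Fin k) (a : CliqueExpr k) : CliqueExpr k

namespace CliqueExpr

/-- The vertices of the graph defined by an expression: one for each vertex creation. -/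
def Vert {k : ℕ} : CliqueExpr k → Type
  | vertex _ => Unit
  | union a b => a.Vert ⊕ b.Vert
  | join _ _ _ a => a.Vert
  | rename _ _ a => a.Vert

/-- The labels of the vertices after all operations of the expression have been applied. -/
def label {k : ℕ} : (e : CliqueExpr k) → e.Vert → Fin k
  | vertex i => fun _ => i
  | union a b => Sum.elim a.label b.label
  | join _ _ _ a => a.label
  | rename i j a => fun v => if a.label v = i then j else a.label v

/-- The graph defined by an expression. -/
def graph {k : ℕ} : (e : CliqueExpr k) → SimpleGraph e.Vert
  | vertex _ => (⊥ : SimpleGraph Unit)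
  | union a b => SimpleGraph.sum a.graph b.graph
  | join i j _ a => a.graph ⊔ SimpleGraph.fromRel (fun u v => a.label u = i ∧ a.label v = j)
  | rename _ _ a => a.graph

end CliqueExpr

/-- The clique-width of a graph: the least number of labels in an expression that defines the graph
up to isomorphism. The graph without vertices has clique-width `0`, and an infinite graph `⊤`. -/
noncomputable def cliqueWidth {V : Type*} (G : SimpleGraph V) : ℕ∞ :=
  ⨅ (k : ℕ) (_ : IsEmpty V ∨ ∃ e : CliqueExpr k, Nonempty (e.graph ≃g G)), (k : ℕ∞)

/-- The graph `𝒫`: the vertex `(i, j)` lies in row `i` and column `j`, and each row is a one-way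
infinite path. -/
def rowPaths : SimpleGraph (ℕ × ℕ) :=
  SimpleGraph.fromRel (fun u v => u.1 = v.1 ∧ v.2 = u.2 + 1)

/-- The pairs `(u, v)`, with `u` in a column `j` and `v` in the column `j + 1`, whose adjacency is
complemented by the letter `α j`: all such pairs for the letter `1`, those with the row of `u`
strictly before the row of `v` for the letter `2`, none for the letter `0`. -/
def Complemented (α : ℕ → Fin 3) (u v : ℕ × ℕ) : Prop :=
  v.2 = u.2 + 1 ∧ (α u.2 = 1 ∨ (α u.2 = 2 ∧ u.1 < v.1))

/-- The graph `𝒫^α`, obtained from `𝒫` by complementing the pairs prescribed by the word `α`. -/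
def wordGraph (α : ℕ → Fin 3) : SimpleGraph (ℕ × ℕ) where
  Adj u v := Xor (rowPaths.Adj u v) (Complemented α u v ∨ Complemented α v u)
  symm := ⟨fun u v h => by rwa [rowPaths.adj_comm, or_comm] at h⟩
  loopless := ⟨fun u h => by simp [Xor, Complemented] at h⟩

/-- Membership in the class `𝒢_α` of all finite induced subgraphs of `𝒫^α`. -/
def InWordClass (α : ℕ → Fin 3) {V : Type} (G : SimpleGraph V) : Prop :=
  Finite V ∧ G.IsIndContained (wordGraph α)

/-- A class of graphs has unbounded clique-width. -/
def HasUnboundedCliqueWidth (X : ∀ {V : Type}, SimpleGraph V → Prop) : Prop :=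
  ∀ c : ℕ, ∃ (V : Type) (G : SimpleGraph V), X G ∧ (c : ℕ∞) < cliqueWidth G

/-! A clique-width expression with `k` labels has, for every size threshold `T` at most the number
of its vertices, a subexpression with between `T` and `2T - 1` vertices; vertices which carry the
same label in that subexpression are never told apart afterwards. So the graph has a set `R` of
controlled size whose vertices have at most `k` different neighbourhoods outside `R`
(`CliqueExpr.exists_cut`).

Colour the vertices of such a set `R` in a finite grid of rows and columns of `𝒫^α` red and all
others blue. There are few columns `j` with an edge between a red and a blue vertex of the columns
`j` and `j + 1`: edges belonging to distant columns form an induced matching, and so their red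
ends have different neighbourhoods among the blue vertices (`eq_of_type_eq_of_mod_eq`).
Consequently few rows contain both colours: a row changing its colour between the columns `j` and
`j + 1` forces a two-coloured edge there (`exists_twoColoured_edge`), and the rows changing their
colour at the same `j` induce a matching, the complement of one, or a half graph, all of which have
pairwise different neighbourhoods (`exists_separating`). If `R` and its complement are large, then
one row is entirely red and another entirely blue, and these two rows produce a two-coloured edge
for every letter `2` (`card_letter_two_le`), hence more of them than possible once the grid has
enough columns. -/

/-- The values of `f` on `R` determine the neighbourhoods in `B`: two vertices of `R` with the same
value have the same neighbours in `B`. -/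
def IsTyping {V L : Type*} (G : SimpleGraph V) (R B : Set V) (f : V → L) : Prop :=
  ∀ ⦃u⦄, u ∈ R → ∀ ⦃v⦄, v ∈ R → ∀ ⦃w⦄, w ∈ B → f u = f v → (G.Adj u w ↔ G.Adj v w)

/-- A typing that determines the labels remains one when the vertices are joined by their labels. -/
theorem IsTyping.sup_fromRel {V L K : Type*} {G : SimpleGraph V} {U : Set V} {f : V → L}
    (h : IsTyping G U Uᶜ f) {label : V → K} (hl : ∀ u ∈ U, ∀ v ∈ U, f u = f v → label u = label v)
    {i j : K} :
    IsTyping (G ⊔ SimpleGraph.fromRel fun u v => label u = i ∧ label v = j) U Uᶜ f := by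
  intro u hu v hv w hw huv
  have huw : u ≠ w := fun h => hw (h ▸ hu)
  have hvw : v ≠ w := fun h => hw (h ▸ hv)
  simp only [SimpleGraph.sup_adj, SimpleGraph.fromRel_adj, h hu hv hw huv, hl u hu v hv huv]
  exact or_congr_right (and_congr_left' (iff_of_true huw hvw))

/-! ### Cuts from clique-width expressions -/

namespace CliqueExpr

variable {k : ℕ}

theorem finite_vert : ∀ e : CliqueExpr k, Finite e.Vert
  | vertex _ => inferInstanceAs (Finite Unit)
  | union a b =>
    haveI := a.finite_vert
    haveI := b.finite_vert
    inferInstanceAs (Finite (a.Vert ⊕ b.Vert))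
  | join _ _ _ a => a.finite_vert
  | rename _ _ a => a.finite_vert

/-- A subexpression of the right size provides the cut, with its labelling as the typing. The typing
refines the final labelling, and so survives all later operations of the expression. -/
theorem exists_cut (e : CliqueExpr k) (T : ℕ) (hT : 1 ≤ T) (h : T ≤ Nat.card e.Vert) :
    ∃ (U : Set e.Vert) (f : e.Vert → Fin k), T ≤ U.ncard ∧ U.ncard < 2 * T ∧
      (∀ u ∈ U, ∀ v ∈ U, f u = f v → e.label u = e.label v) ∧ IsTyping e.graph U Uᶜ f := by
  have base : ∀ e : CliqueExpr k, T ≤ Nat.card e.Vert → Nat.card e.Vert < 2 * T →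
      ∃ (U : Set e.Vert) (f : e.Vert → Fin k), T ≤ U.ncard ∧ U.ncard < 2 * T ∧
        (∀ u ∈ U, ∀ v ∈ U, f u = f v → e.label u = e.label v) ∧ IsTyping e.graph U Uᶜ f :=
    fun e h hlt => ⟨Set.univ, e.label, by rwa [Set.ncard_univ], by rwa [Set.ncard_univ],
      fun _ _ _ _ h => h, fun u _ v _ w hw => absurd (Set.mem_univ w) hw⟩
  by_cases hlt : Nat.card e.Vert < 2 * T
  · exact base e h hlt
  induction e with
  | vertex i =>
    have : Nat.card (vertex i : CliqueExpr k).Vert = 1 := Nat.card_unique (α := Unit)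
    omega
  | union a b iha ihb =>
    have := a.finite_vert
    have := b.finite_vert
    have hcard : Nat.card (union a b).Vert = Nat.card a.Vert + Nat.card b.Vert :=
      Nat.card_sum (α := a.Vert) (β := b.Vert)
    -- The larger of the two parts still reaches the threshold.
    have key : T ≤ Nat.card a.Vert ∨ T ≤ Nat.card b.Vert := by omega
    rcases key with hc | hc
    · obtain ⟨U, f, h1, h2, h3, h4⟩ :=
        (lt_or_ge (Nat.card a.Vert) (2 * T)).elim (base a hc) fun h => iha hc h.not_gt
      have hU : (Sum.inl '' U : Set (a.Vert ⊕ b.Vert)).ncard = U.ncard :=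
        Set.ncard_image_of_injective _ Sum.inl_injective
      refine ⟨(Sum.inl '' U : Set (a.Vert ⊕ b.Vert)), Sum.elim f b.label, h1.trans_eq hU.symm,
        hU.trans_lt h2, ?_, ?_⟩
      · rintro _ ⟨u, hu, rfl⟩ _ ⟨v, hv, rfl⟩ huv
        exact h3 u hu v hv huv
      · rintro _ ⟨u, hu, rfl⟩ _ ⟨v, hv, rfl⟩ (w | w) hw huv
        · exact h4 hu hv (fun hwU => hw ⟨w, hwU, rfl⟩) huv
        · simp [graph]
    · obtain ⟨U, f, h1, h2, h3, h4⟩ :=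
        (lt_or_ge (Nat.card b.Vert) (2 * T)).elim (base b hc) fun h => ihb hc h.not_gt
      have hU : (Sum.inr '' U : Set (a.Vert ⊕ b.Vert)).ncard = U.ncard :=
        Set.ncard_image_of_injective _ Sum.inr_injective
      refine ⟨(Sum.inr '' U : Set (a.Vert ⊕ b.Vert)), Sum.elim a.label f, h1.trans_eq hU.symm,
        hU.trans_lt h2, ?_, ?_⟩
      · rintro _ ⟨u, hu, rfl⟩ _ ⟨v, hv, rfl⟩ huv
        exact h3 u hu v hv huv
      · rintro _ ⟨u, hu, rfl⟩ _ ⟨v, hv, rfl⟩ (w | w) hw huv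
        · simp [graph]
        · exact h4 hu hv (fun hwU => hw ⟨w, hwU, rfl⟩) huv
  | join i j hij a ih =>
    obtain ⟨U, f, h1, h2, h3, h4⟩ := ih h hlt
    exact ⟨U, f, h1, h2, h3, h4.sup_fromRel h3⟩
  | rename i j a ih =>
    obtain ⟨U, f, h1, h2, h3, h4⟩ := ih h hlt
    refine ⟨U, f, h1, h2, fun u hu v hv huv => ?_, h4⟩
    change (if a.label u = i then j else a.label u) = if a.label v = i then j else a.label v
    rw [h3 u hu v hv huv]

end CliqueExpr

/-! ### Adjacency in the graph of a word -/

theorem wordGraph_adj_succ (α : ℕ → Fin 3) (i k j : ℕ) :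
    (wordGraph α).Adj (i, j) (k, j + 1) ↔ Xor (i = k) (α j = 1 ∨ (α j = 2 ∧ i < k)) := by
  have h : ¬ j = j + 1 + 1 := by omega
  simp [wordGraph, rowPaths, Complemented, h]

theorem wordGraph_adj_succ_left (α : ℕ → Fin 3) (i k j : ℕ) :
    (wordGraph α).Adj (k, j + 1) (i, j) ↔ Xor (i = k) (α j = 1 ∨ (α j = 2 ∧ i < k)) := by
  rw [SimpleGraph.adj_comm, wordGraph_adj_succ]

theorem wordGraph_adj_column {α : ℕ → Fin 3} {u v : ℕ × ℕ} (h : (wordGraph α).Adj u v) :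
    v.2 = u.2 + 1 ∨ u.2 = v.2 + 1 := by
  have h : Xor ((rowPaths).Adj u v) (Complemented α u v ∨ Complemented α v u) := h
  simp only [Xor, rowPaths, SimpleGraph.fromRel_adj, Complemented] at h
  tauto

/-! ### Two-coloured edges -/

/-- An edge `rb` between the columns `j` and `j + 1`, in either direction, with its red end `r` in
`R` and its blue end `b` in `B`. -/
structure IsTwoColouredEdge (α : ℕ → Fin 3) (R B : Set (ℕ × ℕ)) (j : ℕ) (r b : ℕ × ℕ) : Prop where
  left_mem : r ∈ R
  right_mem : b ∈ B
  adj : (wordGraph α).Adj r b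
  columns : (r.2 = j ∧ b.2 = j + 1) ∨ (r.2 = j + 1 ∧ b.2 = j)

/-- Two-coloured edges at distant columns form an induced matching, so that their red ends have
different types. -/
theorem eq_of_type_eq_of_mod_eq {α : ℕ → Fin 3} {R B : Set (ℕ × ℕ)} {L : Type*} {f : ℕ × ℕ → L}
    (hf : IsTyping (wordGraph α) R B f) {j j' : ℕ} {r b r' b' : ℕ × ℕ}
    (h : IsTwoColouredEdge α R B j r b) (h' : IsTwoColouredEdge α R B j' r' b')
    (hmod : j % 3 = j' % 3) (hfr : f r = f r') : j = j' := by
  have hadj := (hf h.left_mem h'.left_mem h.right_mem hfr).1 h.adj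
  have h1 := wordGraph_adj_column hadj
  have h2 := h.columns
  have h3 := h'.columns
  omega

theorem IsTwoColouredEdge.of_adj_succ {α : ℕ → Fin 3} {R B : Set (ℕ × ℕ)} {i k j : ℕ}
    (hadj : (wordGraph α).Adj (i, j) (k, j + 1))
    (h : ((i, j) ∈ R ∧ (k, j + 1) ∈ B) ∨ ((i, j) ∈ B ∧ (k, j + 1) ∈ R)) :
    ∃ r b, IsTwoColouredEdge α R B j r b := by
  rcases h with ⟨h1, h2⟩ | ⟨h1, h2⟩
  · exact ⟨_, _, h1, h2, hadj, Or.inl ⟨rfl, rfl⟩⟩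
  · exact ⟨_, _, h2, h1, hadj.symm, Or.inr ⟨rfl, rfl⟩⟩

/-- A row changing its colour after column `j` forces a two-coloured edge there. Its own two vertices
are adjacent unless `α j = 1`; in that case two further rows are needed. -/
theorem exists_twoColoured_edge {α : ℕ → Fin 3} {R B : Set (ℕ × ℕ)} {n m : ℕ} (hn : 3 ≤ n)
    (hRB : ∀ i < n, ∀ j < m, (i, j) ∈ R ∨ (i, j) ∈ B) {i j : ℕ} (hj : j + 1 < m)
    (h : ((i, j) ∈ R ∧ (i, j + 1) ∈ B) ∨ ((i, j) ∈ B ∧ (i, j + 1) ∈ R)) :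
    ∃ r b, IsTwoColouredEdge α R B j r b := by
  by_cases hα : α j = 1
  · obtain ⟨p, q, hp, hq, hpi, hqi, hpq⟩ : ∃ p q, p < n ∧ q < n ∧ p ≠ i ∧ q ≠ i ∧ p ≠ q := by
      rcases (by omega : i = 0 ∨ i = 1 ∨ 2 ≤ i) with h | h | h
      · exact ⟨1, 2, by omega⟩
      · exact ⟨0, 2, by omega⟩
      · exact ⟨0, 1, by omega⟩
    -- The end vertices of the path `(i, j)`, `(p, j + 1)`, `(q, j)`, `(i, j + 1)` have different
    -- colours, and therefore so do the ends of one of its edges.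
    have e1 : (wordGraph α).Adj (i, j) (p, j + 1) := by
      rw [wordGraph_adj_succ]; exact Or.inr ⟨Or.inl hα, hpi.symm⟩
    have e2 : (wordGraph α).Adj (q, j) (p, j + 1) := by
      rw [wordGraph_adj_succ]; exact Or.inr ⟨Or.inl hα, hpq.symm⟩
    have e3 : (wordGraph α).Adj (q, j) (i, j + 1) := by
      rw [wordGraph_adj_succ]; exact Or.inr ⟨Or.inl hα, hqi⟩
    have c1 := hRB p hp (j + 1) hj
    have c2 := hRB q hq j (by omega)
    by_contra hno
    have n1 := mt (IsTwoColouredEdge.of_adj_succ (R := R) (B := B) e1) hno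
    have n2 := mt (IsTwoColouredEdge.of_adj_succ (R := R) (B := B) e2) hno
    have n3 := mt (IsTwoColouredEdge.of_adj_succ (R := R) (B := B) e3) hno
    tauto
  · refine IsTwoColouredEdge.of_adj_succ ?_ h
    rw [wordGraph_adj_succ]
    exact Or.inl ⟨rfl, by simp [hα]⟩

/-- For a letter `2`, a red row and a blue row span a two-coloured edge, from the upper of the two
rows to the lower. -/
theorem exists_twoColoured_edge_of_letter_two {α : ℕ → Fin 3} {R B : Set (ℕ × ℕ)} {a b j : ℕ}
    (hα : α j = 2) (hab : a ≠ b) (ha : ∀ l ≤ j + 1, (a, l) ∈ R) (hb : ∀ l ≤ j + 1, (b, l) ∈ B) :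
    ∃ r b, IsTwoColouredEdge α R B j r b := by
  rcases lt_or_gt_of_ne hab with h | h
  · refine IsTwoColouredEdge.of_adj_succ (i := a) (k := b) ?_
      (Or.inl ⟨ha _ (by omega), hb _ le_rfl⟩)
    rw [wordGraph_adj_succ]
    exact Or.inr ⟨Or.inr ⟨hα, h⟩, h.ne⟩
  · refine IsTwoColouredEdge.of_adj_succ (i := b) (k := a) ?_
      (Or.inr ⟨hb _ (by omega), ha _ le_rfl⟩)
    rw [wordGraph_adj_succ]
    exact Or.inr ⟨Or.inr ⟨hα, h⟩, h.ne⟩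

/-! ### Counting letters and rows -/

/-- Between two consecutive columns, any two rows induce a matching, the complement of one, or a
half graph on two pairs of vertices, so that the neighbourhoods of the two vertices of either column
differ in the other. The conclusion covers both choices for the column of the red vertices. -/
theorem exists_separating (α : ℕ → Fin 3) {i i' : ℕ} (h : i ≠ i') (j : ℕ) :
    (∃ l, (l = i ∨ l = i') ∧
      ¬ ((wordGraph α).Adj (i, j) (l, j + 1) ↔ (wordGraph α).Adj (i', j) (l, j + 1))) ∧
    ∃ l, (l = i ∨ l = i') ∧
      ¬ ((wordGraph α).Adj (i, j + 1) (l, j) ↔ (wordGraph α).Adj (i', j + 1) (l, j)) := by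
  wlog hlt : i < i' generalizing i i'
  · obtain ⟨⟨l, hl, h1⟩, l', hl', h2⟩ := this h.symm (by omega)
    exact ⟨⟨l, hl.symm, fun h => h1 h.symm⟩, l', hl'.symm, fun h => h2 h.symm⟩
  -- In the half graph of the letter `2` only the vertex in the row of the smaller index separates
  -- the left vertices, and only the one in the row of the larger index separates the right ones.
  refine ⟨⟨i, Or.inl rfl, ?_⟩, i', Or.inr rfl, ?_⟩
  · simp only [wordGraph_adj_succ, Xor]
    have h1 : ¬ i' < i := by omega
    simp only [h.symm, h1, lt_irrefl]
    tauto
  · simp only [wordGraph_adj_succ_left, Xor]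
    have h1 : ¬ i' < i := by omega
    simp only [h.symm, h1, lt_irrefl]
    tauto

/-- A row that meets both colours changes its colour between two consecutive columns. -/
theorem exists_colour_change {R B : Set (ℕ × ℕ)} {i m : ℕ}
    (hRB : ∀ j < m, (i, j) ∈ R ∨ (i, j) ∈ B) (hR : ∃ j < m, (i, j) ∈ R) (hB : ∃ j < m, (i, j) ∈ B)
    (hdisj : Disjoint R B) :
    ∃ j, j + 1 < m ∧ (((i, j) ∈ R ∧ (i, j + 1) ∈ B) ∨ ((i, j) ∈ B ∧ (i, j + 1) ∈ R)) := by
  by_contra! hno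
  obtain ⟨a, ham, ha⟩ := hR
  obtain ⟨b, hbm, hb⟩ := hB
  have key : ∀ j < m, ((i, j) ∈ R ↔ (i, 0) ∈ R) := by
    intro j
    induction j with
    | zero => simp
    | succ j ih =>
      intro hj
      rw [← ih (by omega)]
      have h1 := hno j hj
      have h2 := hRB j (by omega)
      have h3 := hRB (j + 1) hj
      have h4 : (i, j) ∈ R → (i, j) ∉ B := fun h => Set.disjoint_left.1 hdisj h
      have h5 : (i, j + 1) ∈ R → (i, j + 1) ∉ B := fun h => Set.disjoint_left.1 hdisj h
      tauto
  exact Set.disjoint_left.1 hdisj ((key b hbm).2 ((key a ham).1 ha)) hb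

/-- Rows with a colour change between the same two columns and in the same direction have red
vertices of different types, which together with the distinctness of types at distant columns
bounds the number of rows meeting both colours. -/
theorem card_mixed_rows_le {α : ℕ → Fin 3} {R B : Set (ℕ × ℕ)} {n m k : ℕ} {f : ℕ × ℕ → Fin k}
    (hf : IsTyping (wordGraph α) R B f) (hn : 3 ≤ n)
    (hRB : ∀ i < n, ∀ j < m, (i, j) ∈ R ∨ (i, j) ∈ B) (hdisj : Disjoint R B) (M : Finset ℕ)
    (hM : ∀ i ∈ M, i < n ∧ (∃ j < m, (i, j) ∈ R) ∧ ∃ j < m, (i, j) ∈ B) :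
    M.card ≤ 6 * k ^ 2 := by
  have hex : ∀ i : M, ∃ (j : ℕ) (d : Bool) (r b : ℕ × ℕ), IsTwoColouredEdge α R B j r b ∧
      bif d then (↑i, j) ∈ R ∧ (↑i, j + 1) ∈ B else (↑i, j) ∈ B ∧ (↑i, j + 1) ∈ R := by
    intro i
    obtain ⟨hin, hr, hb⟩ := hM i i.2
    obtain ⟨j, hj, h⟩ := exists_colour_change (hRB i hin) hr hb hdisj
    obtain ⟨r, b, hrb⟩ := exists_twoColoured_edge (α := α) hn hRB hj h
    rcases h with h | h
    · exact ⟨j, true, r, b, hrb, h⟩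
    · exact ⟨j, false, r, b, hrb, h⟩
  choose j d r b hrb hd using hex
  -- The residue and the type of `r i` determine `j i`; with the direction and the type of the red
  -- vertex of the row next to the colour change, they determine the row.
  let F : M → (ZMod 3 × Fin k) × Bool × Fin k := fun i =>
    (((j i : ZMod 3), f (r i)), d i, f (↑i, bif d i then j i else j i + 1))
  have hF : Function.Injective F := by
    intro x y hxy
    simp only [F, Prod.mk.injEq] at hxy
    obtain ⟨⟨h1, h2⟩, h3, h4⟩ := hxy
    have hj : j x = j y :=
      eq_of_type_eq_of_mod_eq hf (hrb x) (hrb y) ((ZMod.natCast_eq_natCast_iff' _ _ _).1 h1) h2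
    by_contra hne
    obtain ⟨⟨l, hl, hs⟩, l', hl', hs'⟩ :=
      exists_separating α (fun h => hne (Subtype.ext h) : (x : ℕ) ≠ y) (j x)
    have hx := hd x
    have hy := hd y
    rw [← hj, ← h3] at hy h4
    cases hdx : d x with
    | true =>
      simp only [hdx, cond_true] at hx hy h4
      refine hs (hf hx.1 hy.1 ?_ h4)
      rcases hl with rfl | rfl
      exacts [hx.2, hy.2]
    | false =>
      simp only [hdx, cond_false] at hx hy h4
      refine hs' (hf hx.2 hy.2 ?_ h4)
      rcases hl' with rfl | rfl
      exacts [hx.1, hy.1]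
  have hcard := Fintype.card_le_of_injective F hF
  simp only [Fintype.card_coe, Fintype.card_prod, ZMod.card, Fintype.card_fin,
    Fintype.card_bool] at hcard
  calc M.card ≤ 3 * k * (2 * k) := hcard
    _ = 6 * k ^ 2 := by ring

theorem card_letter_two_le {α : ℕ → Fin 3} {R B : Set (ℕ × ℕ)} {m k : ℕ} {f : ℕ × ℕ → Fin k}
    (hf : IsTyping (wordGraph α) R B f) {a b : ℕ} (hab : a ≠ b) (ha : ∀ l < m, (a, l) ∈ R)
    (hb : ∀ l < m, (b, l) ∈ B) (J : Finset ℕ) (hJ : ∀ j ∈ J, α j = 2 ∧ j + 1 < m) :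
    J.card ≤ 3 * k := by
  have hex : ∀ j : J, ∃ r b, IsTwoColouredEdge α R B j r b := fun j =>
    exists_twoColoured_edge_of_letter_two (hJ j j.2).1 hab
      (fun l hl => ha l (hl.trans_lt (hJ j j.2).2)) (fun l hl => hb l (hl.trans_lt (hJ j j.2).2))
  choose r b hrb using hex
  have hF : Function.Injective (fun j : J => (((j : ℕ) : ZMod 3), f (r j))) := by
    intro x y hxy
    rw [Prod.mk.injEq] at hxy
    exact Subtype.ext (eq_of_type_eq_of_mod_eq hf (hrb x) (hrb y)
      ((ZMod.natCast_eq_natCast_iff' _ _ _).1 hxy.1) hxy.2)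
  simpa using Fintype.card_le_of_injective _ hF

/-! ### Cuts of a grid -/

/-- Without a row inside `X`, every row meeting `X` also meets `Y`, so that `X` lies in the at most
`s` rows meeting both. -/
theorem exists_full_row {X Y : Set (ℕ × ℕ)} {n m s : ℕ}
    (hX : X ⊆ {p | p.1 < n ∧ p.2 < m}) (hXY : ∀ i < n, ∀ j < m, (i, j) ∈ X ∨ (i, j) ∈ Y)
    (hs : ∀ M : Finset ℕ, (∀ i ∈ M, i < n ∧ (∃ j < m, (i, j) ∈ X) ∧ ∃ j < m, (i, j) ∈ Y) →
      M.card ≤ s) (hcard : s * m < X.ncard) :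
    ∃ i < n, ∀ j < m, (i, j) ∈ X := by
  classical
  by_contra! hno
  let M := (Finset.range n).filter fun i => ∃ j < m, (i, j) ∈ X
  have hM : M.card ≤ s := hs M fun i hi => by
    obtain ⟨hin, hiX⟩ := Finset.mem_filter.1 hi
    have hin := Finset.mem_range.1 hin
    obtain ⟨j, hj, hjX⟩ := hno i hin
    exact ⟨hin, hiX, j, hj, (hXY i hin j hj).resolve_left hjX⟩
  have hsub : X ⊆ ↑(M ×ˢ Finset.range m) := fun p hp => by
    have := hX hp
    simp only [Finset.coe_product, Set.mem_prod, Finset.mem_coe, Finset.mem_range, M,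
      Finset.mem_filter]
    exact ⟨⟨this.1, p.2, this.2, hp⟩, this.2⟩
  have h1 := Set.ncard_le_ncard hsub (Finset.finite_toSet _)
  rw [Set.ncard_coe_finset, Finset.card_product, Finset.card_range] at h1
  have := Nat.mul_le_mul_right m hM
  omega

/-- A large set with a large complement in a grid with many letters `2` has many types. -/
theorem card_letter_two_le_of_cut {α : ℕ → Fin 3} {n m k : ℕ} {R B : Set (ℕ × ℕ)}
    {f : ℕ × ℕ → Fin k} (hf : IsTyping (wordGraph α) R B f) (hn : 3 ≤ n)
    (hunion : R ∪ B = {p | p.1 < n ∧ p.2 < m}) (hdisj : Disjoint R B)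
    (hR : 6 * k ^ 2 * m < R.ncard) (hB : 6 * k ^ 2 * m < B.ncard) (J : Finset ℕ)
    (hJ : ∀ j ∈ J, α j = 2 ∧ j + 1 < m) : J.card ≤ 3 * k := by
  have hRB : ∀ i < n, ∀ j < m, (i, j) ∈ R ∨ (i, j) ∈ B := fun i hi j hj =>
    hunion.ge (show (i, j) ∈ {p : ℕ × ℕ | p.1 < n ∧ p.2 < m} from ⟨hi, hj⟩)
  have hM := card_mixed_rows_le hf hn hRB hdisj
  obtain ⟨a, -, ha⟩ := exists_full_row (Set.subset_union_left.trans hunion.le) hRB hM hR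
  obtain ⟨b, -, hb⟩ := exists_full_row (Set.subset_union_right.trans hunion.le)
    (fun i hi j hj => (hRB i hi j hj).symm) (fun M h => hM M fun i hi => ⟨(h i hi).1, (h i hi).2.symm⟩)
    hB
  rcases J.eq_empty_or_nonempty with rfl | ⟨j, hj⟩
  · simp
  have hm : 0 < m := by have := (hJ j hj).2; omega
  refine card_letter_two_le hf ?_ ha hb J hJ
  rintro rfl
  exact Set.disjoint_left.1 hdisj (ha 0 hm) (hb 0 hm)

/-- The bound `n ≥ 18 k ^ 2 + 3` lets both sides of a cut with threshold `6 k ^ 2 m + 1` exceed the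
number of vertices in the rows that meet both sides. -/
theorem card_letter_two_le_of_expr {α : ℕ → Fin 3} {n m k : ℕ} (hn : 18 * k ^ 2 + 3 ≤ n)
    (hm : 0 < m) (e : CliqueExpr k)
    (φ : e.graph ≃g (wordGraph α).induce {p | p.1 < n ∧ p.2 < m}) (J : Finset ℕ)
    (hJ : ∀ j ∈ J, α j = 2 ∧ j + 1 < m) : J.card ≤ 3 * k := by
  set S : Set (ℕ × ℕ) := {p | p.1 < n ∧ p.2 < m} with hS
  have hScard : S.ncard = n * m := by
    have : S = ↑(Finset.range n ×ˢ Finset.range m) := by ext p; simp [hS]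
    rw [this, Set.ncard_coe_finset, Finset.card_product, Finset.card_range, Finset.card_range]
  have hecard : Nat.card e.Vert = n * m := by
    rw [Nat.card_congr φ.toEquiv, Nat.card_coe_set_eq, hScard]
  have hnm : 3 * (6 * k ^ 2 * m + 1) ≤ n * m := by nlinarith
  obtain ⟨U, f, h1, h2, -, h4⟩ := e.exists_cut (6 * k ^ 2 * m + 1) (by omega) (by omega)
  let g : e.Vert → ℕ × ℕ := fun x => (φ x : ℕ × ℕ)
  have hg : Function.Injective g := Subtype.val_injective.comp φ.injective
  have hrange : Set.range g = S := by
    rw [show g = Subtype.val ∘ φ from rfl, Set.range_comp, φ.surjective.range_eq, Set.image_univ,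
      Subtype.range_coe]
  have hadj : ∀ x y, (wordGraph α).Adj (g x) (g y) ↔ e.graph.Adj x y := fun x y => φ.map_rel_iff
  have := e.finite_vert
  have hpart := Set.ncard_add_ncard_compl U
  obtain ⟨x₀⟩ : Nonempty e.Vert := (Nat.card_pos_iff.1 (by omega)).1
  have hext := hg.extend_apply f fun _ => f x₀
  refine card_letter_two_le_of_cut (R := g '' U) (B := g '' Uᶜ) (n := n)
    (f := Function.extend g f fun _ => f x₀) ?_ (by omega) ?_ ?_ ?_ ?_ J hJ
  · rintro _ ⟨u, hu, rfl⟩ _ ⟨v, hv, rfl⟩ _ ⟨w, hw, rfl⟩ huv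
    rw [hext, hext] at huv
    rw [hadj, hadj]
    exact h4 hu hv hw huv
  · rw [← Set.image_union, Set.union_compl_self, Set.image_univ, hrange]
  · exact (Set.disjoint_image_iff hg).2 disjoint_compl_right
  · rw [Set.ncard_image_of_injective _ hg]; omega
  · rw [Set.ncard_image_of_injective _ hg]; omega

theorem lemma8 (α : ℕ → Fin 3) (hα : {j : ℕ | α j = 2}.Infinite) :
    HasUnboundedCliqueWidth (fun {V : Type} (G : SimpleGraph V) => InWordClass α G) := by
  intro c
  obtain ⟨J, hJ, hJcard⟩ := hα.exists_subset_card_eq (3 * c + 1)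
  let n := 18 * c ^ 2 + 3
  let m := J.sup id + 2
  let S : Set (ℕ × ℕ) := {p | p.1 < n ∧ p.2 < m}
  have hSfin : S.Finite :=
    ((Set.finite_Iio n).prod (Set.finite_Iio m)).subset fun p hp => ⟨hp.1, hp.2⟩
  refine ⟨S, (wordGraph α).induce S, ⟨hSfin, ⟨SimpleGraph.Embedding.induce S⟩⟩, ?_⟩
  refine (ENat.natCast_lt_natCast.2 c.lt_succ_self).trans_le (le_iInf₂ fun k hk => Nat.cast_le.2 ?_)
  by_contra! hkc
  have hkc : k ≤ c := Nat.lt_succ_iff.1 hkc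
  rcases hk with hk | ⟨e, ⟨φ⟩⟩
  · exact hk.false ⟨(0, 0), by simp [S, n, m]⟩
  · have hn : 18 * k ^ 2 + 3 ≤ n := by
      have := Nat.pow_le_pow_left hkc 2
      simp only [n]
      omega
    have := card_letter_two_le_of_expr hn (by simp [m]) e φ J fun j hj =>
      ⟨hJ hj, by have : j ≤ J.sup id := Finset.le_sup (f := id) hj; simp only [m]; omega⟩
    omega
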